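/- Let $0<b<1$ and let $(\alpha_n)_{n\ge 1}$ be positive reals with $\sum_{n\ge1}\alpha_n<2(1-b)$, $\alpha_{n+1}<\alpha_n$ for all $n\ge 1$, $\lim_{n\to\infty}\alpha_{n+1}/\alpha_n=1$ and $\alpha_1<2b$. To each finite word $a$ of $0$'s and $1$'s associate a closed interval $I_a\subset[-1,1]$ (an atom) and an open interval $I^*_a\subset I_a$ (a gap) as follows: $I_\emptyset=[-1,1]$ and $I^*_\emptyset=(-b,b)$; if $a$ has length $n\ge1$, then $I^*_a$ is the open interval of length $\alpha_n/2^n$ with the same centre as $I_a$; and for every word $a$, $I_{a0}$ and $I_{a1}$ are the closed intervals at the left and at the right of $I^*_a$ such that $I_a=I_{a0}\cup I^*_a\cup I_{a1}$. In particular $I_0=[-1,-b]$ and $I_1=[b,1]$. Let $K=\bigcap_{n\ge1}\bigcup_{a\in\{0,1\}^n}I_a$. Let $G:I_0\cup I_1\to[-1,1]$ be any continuous map such that, for every $n\ge 0$ and every word $a_0a_1\dots a_n$, the restriction of $G$ to the gap $I^*_{a_0a_1\dots a_n}$ is an order preserving $C^1$ map onto the gap $I^*_{a_1\dots a_n}$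 that is expanding (its derivative is bounded below by a constant larger than $1$), with $G'(x)\to2$ as $x$ tends to either endpoint of $I^*_{a_0a_1\dots a_n}$ from inside the gap; and such that, for some sequence $\epsilon_n\to0$, $|G'(x)-2|<\epsilon_n$ for all $n\ge1$ and all $x$ in the gaps $I^*_{a_0a_1\dots a_n}$. Let $G_c:[-b,b]\to[-1,1]$ be any order preserving, surjective, $C^1$ expanding map with $G_c'(x)\to2$ as $x\to-b^+$ and as $x\to b^-$. Let $f$ be the map of the circle $S^1=[-1,1]/(-1\sim1)$ induced by $G$ on $I_0\cup I_1$ and by $G_c$ on $(-b,b)$. Let $m$ be the Lebesgue measure on $S^1$, and let $\mu_K(B)=m(B\cap K)/m(K)$ for Borel sets $B\subset S^1$. Then $\mu_K$ is a physical measure of $f$: it is an $f$-invariant Borel probability measure, and its basin of statistical attraction $$B(\mu_K)=\Big\{x\in S^1:\ \lim_{n\to\infty}\frac1n\sum_{j=0}^{n-1}\varphi(f^j(x))=\int\varphi\,d\mu_K\ \text{ for every continuous }\varphi:S^1\to\mathbb R\Big\}$$ (the set of points $x$ whose empiric probabilities $\frac1n\sum_{j=0}^{n-1}\delta_{f^j(x)}$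 converge weak$^*$ to $\mu_K$) satisfies $m(B(\mu_K))>0$. -/

import Mathlib

open Set Filter Topology MeasureTheory

noncomputable section

namespace BowenCircle

/-! ### Empiric probabilities, statistical basins, physical measures -/

section Physical

variable {X : Type*} [TopologicalSpace X] [MeasurableSpace X]

/-- The empiric probability `σ_n(x) = (1/n) ∑_{j<n} δ_{f^j(x)}` (meaningful for `n ≥ 1`). -/
def empiricMeasure (f : X → X) (n : ℕ) (x : X) : Measure X :=
  (n : ENNReal)⁻¹ • ∑ j ∈ Finset.range n, Measure.dirac (f^[j] x)

/-- Weak* convergence: convergence of the integrals of all continuous real functions. -/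
def WeakStarTendsto (ν : ℕ → Measure X) (μ : Measure X) : Prop :=
  ∀ φ : X → ℝ, Continuous φ → Tendsto (fun n => ∫ y, φ y ∂(ν n)) atTop (𝓝 (∫ y, φ y ∂μ))

/-- The basin of statistical attraction `B(μ)` of `μ` under `f`. -/
def basin (f : X → X) (μ : Measure X) : Set X :=
  {x | WeakStarTendsto (fun n => empiricMeasure f n x) μ}

/-- `μ` is a physical measure of `f`, with respect to the reference (Lebesgue) measure `m`:
an `f`-invariant probability measure whose basin has positive `m`-measure. -/
structure IsPhysical (f : X → X) (m μ : Measure X) : Prop where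
  isProbabilityMeasure : IsProbabilityMeasure μ
  invariant : MeasurePreserving f μ μ
  basin_pos : 0 < m (basin f μ)

end Physical

/-! ### Step 1: the Cantor set -/

/-- The conditions on the number `b = b₀` and on the sequence `α₁, α₂, …` (the value `α 0` is
not used). -/
structure Admissible (b : ℝ) (α : ℕ → ℝ) : Prop where
  b_pos : 0 < b
  b_lt_one : b < 1
  pos : ∀ n, 1 ≤ n → 0 < α n
  summable : Summable fun n => α (n + 1)
  tsum_lt : ∑' n, α (n + 1) < 2 * (1 - b)
  decreasing : ∀ n, 1 ≤ n → α (n + 1) < α n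
  ratio : Tendsto (fun n => α (n + 1) / α n) atTop (𝓝 1)
  first_lt : α 1 < 2 * b

/-- The length of each gap of generation `n`: it is `2 b` for `n = 0`, and `α_n / 2^n` for
`n ≥ 1`. -/
def gapLength (b : ℝ) (α : ℕ → ℝ) : ℕ → ℝ
  | 0 => 2 * b
  | n + 1 => α (n + 1) / 2 ^ (n + 1)

/-- The pair (left endpoint, right endpoint) of the atom of generation `n` named by the word
`a = a₀ a₁ … a_{n-1}`. The atom of the empty word is `[-1, 1]`. Removing from an atom of
generation `n` the open interval of length `gapLength b α n` with the same centre leaves two closed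
intervals: the left one is named by the word followed by `0`, the right one by the word followed
by `1`. -/
def atomEnds (b : ℝ) (α : ℕ → ℝ) : (n : ℕ) → (Fin n → Fin 2) → ℝ × ℝ
  | 0, _ => (-1, 1)
  | n + 1, a =>
    let I := atomEnds b α n (fun i => a i.castSucc)
    let c := (I.1 + I.2) / 2
    if a (Fin.last n) = 0 then (I.1, c - gapLength b α n / 2)
    else (c + gapLength b α n / 2, I.2)

/-- The atom `I_a` of generation `n`, for a word `a` of length `n`. -/
def atom (b : ℝ) (α : ℕ → ℝ) (n : ℕ) (a : Fin n → Fin 2) : Set ℝ :=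
  Icc (atomEnds b α n a).1 (atomEnds b α n a).2

/-- The centre of the atom `I_a`. -/
def atomCentre (b : ℝ) (α : ℕ → ℝ) (n : ℕ) (a : Fin n → Fin 2) : ℝ :=
  ((atomEnds b α n a).1 + (atomEnds b α n a).2) / 2

/-- The left endpoint of the gap `I*_a`. -/
def gapLeft (b : ℝ) (α : ℕ → ℝ) (n : ℕ) (a : Fin n → Fin 2) : ℝ :=
  atomCentre b α n a - gapLength b α n / 2

/-- The right endpoint of the gap `I*_a`. -/
def gapRight (b : ℝ) (α : ℕ → ℝ) (n : ℕ) (a : Fin n → Fin 2) : ℝ :=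
  atomCentre b α n a + gapLength b α n / 2

/-- The gap `I*_a` of generation `n`: the open interval of length `gapLength b α n` centred at the
centre of the atom `I_a`. For `n = 0` it is `(-b, b)`. -/
def gap (b : ℝ) (α : ℕ → ℝ) (n : ℕ) (a : Fin n → Fin 2) : Set ℝ :=
  Ioo (gapLeft b α n a) (gapRight b α n a)

/-- The Cantor set `K = ⋂_{n ≥ 1} ⋃_{a ∈ {0,1}^n} I_a` in `[-1, 1]`. -/
def cantorSet (b : ℝ) (α : ℕ → ℝ) : Set ℝ :=
  ⋂ n : ℕ, ⋃ a : Fin (n + 1) → Fin 2, atom b α (n + 1) a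

/-! ### Step 2: the map `G` on `[-1, -b] ∪ [b, 1]`, and the circle map -/

/-- `G` restricted to `[-1, -b] ∪ [b, 1]` is a map obtained by the construction: every gap
`I*_{a₀ a₁ … a_n}` of generation `n + 1` is mapped onto the gap `I*_{a₁ … a_n}` of generation `n`
by an order preserving `C¹` expanding map whose derivative tends to `2` at both ends of the gap;
the derivative on the gaps of generation `n + 1` is uniformly `ε_n`-close to `2` with `ε_n → 0`; and
`G` is the continuous extension to `[-1, -b] ∪ [b, 1]`. Values of `G` elsewhere are irrelevant. -/
structure IsBowenMap (b : ℝ) (α : ℕ → ℝ) (G : ℝ → ℝ) : Prop where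
  continuousOn : ContinuousOn G (Icc (-1) (-b) ∪ Icc b 1)
  image_gap : ∀ (n : ℕ) (a : Fin (n + 1) → Fin 2),
    G '' gap b α (n + 1) a = gap b α n (fun i => a i.succ)
  strictMonoOn_gap : ∀ (n : ℕ) (a : Fin (n + 1) → Fin 2), StrictMonoOn G (gap b α (n + 1) a)
  contDiffOn_gap : ∀ (n : ℕ) (a : Fin (n + 1) → Fin 2), ContDiffOn ℝ 1 G (gap b α (n + 1) a)
  expanding_gap : ∀ (n : ℕ) (a : Fin (n + 1) → Fin 2),
    ∃ lam : ℝ, 1 < lam ∧ ∀ x ∈ gap b α (n + 1) a, lam ≤ deriv G x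
  deriv_tendsto_left : ∀ (n : ℕ) (a : Fin (n + 1) → Fin 2),
    Tendsto (deriv G) (𝓝[>] gapLeft b α (n + 1) a) (𝓝 2)
  deriv_tendsto_right : ∀ (n : ℕ) (a : Fin (n + 1) → Fin 2),
    Tendsto (deriv G) (𝓝[<] gapRight b α (n + 1) a) (𝓝 2)
  deriv_close : ∃ ε : ℕ → ℝ, Tendsto ε atTop (𝓝 0) ∧
    ∀ n, 1 ≤ n → ∀ (a : Fin (n + 1) → Fin 2), ∀ x ∈ gap b α (n + 1) a, |deriv G x - 2| < ε n

/-- `Gc` restricted to `[-b, b]` is an order preserving `C¹` expanding map onto `[-1, 1]`, whose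
derivative tends to `2` at both ends. -/
structure IsCentralBranch (b : ℝ) (Gc : ℝ → ℝ) : Prop where
  image : Gc '' Icc (-b) b = Icc (-1) 1
  strictMonoOn : StrictMonoOn Gc (Icc (-b) b)
  contDiffOn : ContDiffOn ℝ 1 Gc (Icc (-b) b)
  expanding : ∃ lam : ℝ, 1 < lam ∧ ∀ x ∈ Icc (-b) b, lam ≤ derivWithin Gc (Icc (-b) b) x
  deriv_tendsto_left : Tendsto (deriv Gc) (𝓝[>] (-b)) (𝓝 2)
  deriv_tendsto_right : Tendsto (deriv Gc) (𝓝[<] b) (𝓝 2)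

open Classical in
/-- The interval map: `Gc` on `(-b, b)`, and `G` on `[-1, -b]` and on `[b, 1]`. -/
def intervalMap (b : ℝ) (G Gc : ℝ → ℝ) (x : ℝ) : ℝ :=
  if x ∈ Ioo (-b) b then Gc x else G x

instance fact_two_pos : Fact ((0 : ℝ) < 2) := ⟨two_pos⟩

/-- The circle `[-1, 1] / (-1 ∼ 1)`, realised as `ℝ / 2ℤ`; its `volume` is the Lebesgue measure,
of total mass `2`. -/
abbrev Circle2 : Type := AddCircle (2 : ℝ)

/-- The map of the circle induced by the interval map: the class of `x ∈ [-1, 1)` goes to the class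
of `intervalMap b G Gc x`. -/
def circleMap (b : ℝ) (G Gc : ℝ → ℝ) : Circle2 → Circle2 :=
  AddCircle.liftIco 2 (-1) (fun x => (intervalMap b G Gc x : Circle2))

/-- The Cantor set `K` as a subset of the circle. -/
def circleCantorSet (b : ℝ) (α : ℕ → ℝ) : Set Circle2 :=
  (fun x : ℝ => (x : Circle2)) '' cantorSet b α

/-- The measure `μ_K(B) = m(B ∩ K) / m(K)` on the circle. -/
def muK (b : ℝ) (α : ℕ → ℝ) : Measure Circle2 :=
  (volume (circleCantorSet b α))⁻¹ • volume.restrict (circleCantorSet b α)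

end BowenCircle

end

/-! On K the system is a fair coin-tossing shift. A digit sequence `ω` determines a nested sequence
of atoms whose lengths tend to 0, hence a point `coding b α ω` of K. Since G is continuous and sends
the gap of a word onto the gap of the word without its first letter, G acts on codings as the shift
(`IsBowenMap.apply_coding`). This survives the identification of -1 with 1
(`circleMap_circleCoding`).

All atoms of one generation have the same length, and their total length tends to m(K) =
`cantorMass` > 0. Comparing integrals over the atoms of generation n with averages over words of
length n shows that Lebesgue measure on K, once normalised, is the image of the fair coin measure
(`volume_restrict_cantorSet`, `muK_eq_map_circleCoding`). Invariance of μ_K is then shift invariance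
of the coin measure.

By the strong law of large numbers, almost every `ω` has the right frequency for every finite word
(`ae_forall_tendsto_window_average`). A continuous function on the circle is uniformly close, along
codings, to a function of finitely many digits, so the coding of almost every `ω` lies in the basin.
As μ_K is absolutely continuous with respect to m, a set containing μ_K-almost every point cannot be
m-null. -/

noncomputable section

namespace BowenCircle

/-! ### Frequencies of words under a Bernoulli measure -/

section Bernoulli

/-- A bounded sequence whose Cesàro averages along every residue class modulo `M` converge to `p`
has Cesàro averages converging to `p`. -/
theorem tendsto_average_of_residues {M : ℕ} (hM : 0 < M) {y : ℕ → ℝ} {C p : ℝ}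
    (hy : ∀ j, |y j| ≤ C)
    (h : ∀ r < M, Tendsto (fun q : ℕ => (∑ i ∈ Finset.range q, y (M * i + r)) / q) atTop (𝓝 p)) :
    Tendsto (fun n : ℕ => (∑ j ∈ Finset.range n, y j) / n) atTop (𝓝 p) := by
  have hMR : (0 : ℝ) < M := by exact_mod_cast hM
  have hsum : ∀ q : ℕ, ∑ j ∈ Finset.range (M * q), y j
      = ∑ r ∈ Finset.range M, ∑ i ∈ Finset.range q, y (M * i + r) := by
    intro q
    induction q with
    | zero => simp
    | succ q ih =>
      rw [Nat.mul_succ, Finset.sum_range_add, ih, ← Finset.sum_add_distrib]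
      exact Finset.sum_congr rfl fun r _ => (Finset.sum_range_succ _ _).symm
  have hblock : Tendsto (fun q : ℕ => (∑ j ∈ Finset.range (M * q), y j) / q) atTop
      (𝓝 (M * p)) := by
    have := tendsto_finsetSum (Finset.range M) fun r hr => h r (Finset.mem_range.1 hr)
    simp only [Finset.sum_const, Finset.card_range, nsmul_eq_mul] at this
    refine this.congr fun q => ?_
    rw [hsum, Finset.sum_div]
  have hdiv : Tendsto (fun n : ℕ => n / M) atTop atTop := Nat.tendsto_div_const_atTop hM.ne'
  have hratio : Tendsto (fun n : ℕ => ((n / M : ℕ) : ℝ) / n) atTop (𝓝 (1 / M)) := by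
    have h1 := (tendsto_nat_floor_mul_div_atTop (R := ℝ) (a := 1 / M) (by positivity)).comp
      tendsto_natCast_atTop_atTop
    refine h1.congr fun n => ?_
    simp only [Function.comp]
    rw [← Nat.floor_div_eq_div (K := ℝ) n M]
    congr 3
    ring
  have hmain : Tendsto (fun n : ℕ => (∑ j ∈ Finset.range (M * (n / M)), y j) / n) atTop
      (𝓝 p) := by
    have h1 := (hblock.comp hdiv).mul hratio
    rw [show (M : ℝ) * p * (1 / M) = p by field_simp] at h1
    refine h1.congr' ?_
    -- For n < M the quotient `n / M` is 0 and cannot be cancelled.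
    filter_upwards [eventually_ge_atTop M] with n hn
    have : ((n / M : ℕ) : ℝ) ≠ 0 := by
      have := Nat.div_pos hn hM
      positivity
    simp only [Function.comp]
    field_simp
  -- The incomplete last block has fewer than M terms, each at most C in absolute value.
  have herr : Tendsto (fun n : ℕ => (∑ j ∈ Finset.range n, y j) / n
      - (∑ j ∈ Finset.range (M * (n / M)), y j) / n) atTop (𝓝 0) := by
    refine squeeze_zero_norm (a := fun n : ℕ => (M * C) / n) (fun n => ?_)
      (tendsto_const_div_atTop_nhds_zero_nat _)
    have hC : 0 ≤ C := (abs_nonneg _).trans (hy 0)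
    have hn : Finset.range n = Finset.range (M * (n / M) + n % M) := by rw [Nat.div_add_mod]
    rw [← sub_div, hn, Finset.sum_range_add, add_sub_cancel_left, norm_div, Real.norm_eq_abs,
      Real.norm_eq_abs, Nat.abs_cast]
    gcongr
    calc |∑ x ∈ Finset.range (n % M), y (M * (n / M) + x)|
        ≤ ∑ x ∈ Finset.range (n % M), |y (M * (n / M) + x)| := Finset.abs_sum_le_sum_abs _ _
      _ ≤ ∑ x ∈ Finset.range (n % M), C := Finset.sum_le_sum fun _ _ => hy _
      _ = (n % M : ℕ) * C := by simp
      _ ≤ M * C := by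
        gcongr
        exact (Nat.mod_lt _ hM).le
  simpa using herr.add hmain

variable {A : Type*} [MeasurableSpace A] (ν : Measure A) [IsProbabilityMeasure ν]

theorem map_window_infinitePi (k j : ℕ) :
    (Measure.infinitePi fun _ : ℕ => ν).map (fun ω (i : Fin k) => ω (j + i))
      = Measure.pi fun _ : Fin k => ν := by
  rw [← Measure.infinitePi_eq_pi]
  exact Measure.map_infinitePi_infinitePi_of_inj (P := fun _ : ℕ => ν)
    (f := fun i : Fin k => j + (i : ℕ)) fun i i' h => Fin.ext (by simpa using h)

theorem indepFun_windows (k : ℕ) {i j : ℕ} (hij : i + k ≤ j) :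
    ProbabilityTheory.IndepFun (fun (ω : ℕ → A) (t : Fin k) => ω (i + t))
      (fun (ω : ℕ → A) (t : Fin k) => ω (j + t)) (Measure.infinitePi fun _ : ℕ => ν) := by
  have h := ProbabilityTheory.iIndepFun_infinitePi (P := fun _ : ℕ => ν)
    (X := fun _ x => x) fun _ => measurable_id
  have hd : Disjoint (Finset.Ico i (i + k)) (Finset.Ico j (j + k)) := by
    rw [Finset.disjoint_left]
    intro x hx hx'
    simp only [Finset.mem_Ico] at hx hx'
    omega
  have h2 := h.indepFun_finset _ _ hd fun n => measurable_pi_apply n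
  exact h2.comp
    (φ := fun (w : Finset.Ico i (i + k) → A) (t : Fin k) => w ⟨i + t, by simp⟩)
    (ψ := fun (w : Finset.Ico j (j + k) → A) (t : Fin k) => w ⟨j + t, by simp⟩)
    (by fun_prop) (by fun_prop)

variable [Fintype A] [MeasurableSingletonClass A]

/-- Overlapping windows are not independent. Along a residue class modulo k + 1 the windows are
disjoint, hence pairwise independent and identically distributed, which is all the strong law
requires. The modulus k + 1 rather than k keeps it positive when k = 0. -/
theorem ae_tendsto_window_average (k : ℕ) (g : (Fin k → A) → ℝ) :
    ∀ᵐ ω ∂(Measure.infinitePi fun _ : ℕ => ν),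
      Tendsto (fun n : ℕ => (∑ j ∈ Finset.range n, g (fun i => ω (j + i))) / n) atTop
        (𝓝 (∫ w, g w ∂(Measure.pi fun _ : Fin k => ν))) := by
  have hg : Measurable g := .of_discrete
  have hwin : ∀ j, Measurable fun (ω : ℕ → A) (i : Fin k) => ω (j + i) := fun j => by fun_prop
  have hres : ∀ᵐ ω ∂(Measure.infinitePi fun _ : ℕ => ν), ∀ r : ℕ,
      Tendsto (fun n : ℕ => (∑ j ∈ Finset.range n, g (fun i => ω ((k + 1) * j + r + i))) / n)
        atTop (𝓝 (∫ w, g w ∂(Measure.pi fun _ : Fin k => ν))) := by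
    rw [ae_all_iff]
    intro r
    have hmean : ∫ w, g w ∂(Measure.pi fun _ : Fin k => ν)
        = ∫ ω : ℕ → A, g (fun i => ω ((k + 1) * 0 + r + i))
          ∂(Measure.infinitePi fun _ : ℕ => ν) := by
      rw [← map_window_infinitePi ν k ((k + 1) * 0 + r),
        integral_map (hwin _).aemeasurable hg.aestronglyMeasurable]
    rw [hmean]
    refine ProbabilityTheory.strong_law_ae_real
      (fun j (ω : ℕ → A) => g (fun i => ω ((k + 1) * j + r + i))) ?_ ?_ ?_
    · have h1 : Integrable g (Measure.pi fun _ : Fin k => ν) := .of_finite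
      rw [← map_window_infinitePi ν k ((k + 1) * 0 + r)] at h1
      exact h1.comp_measurable (hwin _)
    · intro i j hij
      rcases lt_or_gt_of_ne hij with h | h
      · refine (indepFun_windows ν k ?_).comp hg hg
        nlinarith
      · refine ((indepFun_windows ν k ?_).comp hg hg).symm
        nlinarith
    · intro i
      have : ProbabilityTheory.IdentDistrib
          (fun (ω : ℕ → A) (t : Fin k) => ω ((k + 1) * i + r + t))
          (fun (ω : ℕ → A) (t : Fin k) => ω ((k + 1) * 0 + r + t))
          (Measure.infinitePi fun _ : ℕ => ν) (Measure.infinitePi fun _ : ℕ => ν) :=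
        ⟨(hwin _).aemeasurable, (hwin _).aemeasurable, by
          rw [map_window_infinitePi, map_window_infinitePi]⟩
      exact this.comp hg
  filter_upwards [hres] with ω hω
  obtain ⟨C, hC⟩ := (Set.finite_range fun w => |g w|).bddAbove
  exact tendsto_average_of_residues (M := k + 1) k.succ_pos
    (fun j => hC ⟨fun i : Fin k => ω (j + i), rfl⟩) fun r _ => hω r

/-- Almost every sequence is generic for all functions of finitely many coordinates. -/
theorem ae_forall_tendsto_window_average :
    ∀ᵐ ω ∂(Measure.infinitePi fun _ : ℕ => ν), ∀ (k : ℕ) (g : (Fin k → A) → ℝ),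
      Tendsto (fun n : ℕ => (∑ j ∈ Finset.range n, g (fun i => ω (j + i))) / n) atTop
        (𝓝 (∫ w, g w ∂(Measure.pi fun _ : Fin k => ν))) := by
  classical
  -- There are countably many pairs (k, a), so a single null set serves all the words. The functions
  -- g form an uncountable family and are recovered as finite linear combinations of indicators of
  -- words.
  have h : ∀ᵐ ω ∂(Measure.infinitePi fun _ : ℕ => ν), ∀ (k : ℕ) (a : Fin k → A),
      Tendsto (fun n : ℕ => (∑ j ∈ Finset.range n,
        (if (fun i : Fin k => ω (j + i)) = a then (1 : ℝ) else 0)) / n) atTop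
        (𝓝 (∫ w, (if w = a then (1 : ℝ) else 0) ∂(Measure.pi fun _ : Fin k => ν))) := by
    rw [ae_all_iff]
    intro k
    rw [ae_all_iff]
    intro a
    exact ae_tendsto_window_average ν k fun w => if w = a then (1 : ℝ) else 0
  filter_upwards [h] with ω hω k g
  have hg : ∀ w, g w = ∑ a, g a * (if w = a then (1 : ℝ) else 0) := fun w => by simp
  have h1 := tendsto_finsetSum Finset.univ fun a (_ : a ∈ Finset.univ) =>
    (hω k a).const_mul (g a)
  have h2 : ∫ w, g w ∂(Measure.pi fun _ : Fin k => ν) = ∑ a, g a *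
      ∫ w, (if w = a then (1 : ℝ) else 0) ∂(Measure.pi fun _ : Fin k => ν) := by
    simp_rw [← integral_const_mul]
    rw [← integral_finsetSum _ fun _ _ => .of_finite]
    exact integral_congr_ae (ae_of_all _ hg)
  rw [h2]
  refine h1.congr fun n => ?_
  simp_rw [← mul_div_assoc]
  rw [← Finset.sum_div]
  congr 1
  simp_rw [Finset.mul_sum]
  rw [Finset.sum_comm]
  exact Finset.sum_congr rfl fun j _ => (hg _).symm

end Bernoulli

/-! ### Geometry of the atoms -/

/-- The common length of the atoms of generation `n`. -/
def atomLength (b : ℝ) (α : ℕ → ℝ) : ℕ → ℝ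
  | 0 => 2
  | n + 1 => (atomLength b α n - gapLength b α n) / 2

/-- The Lebesgue measure of the Cantor set. -/
def cantorMass (b : ℝ) (α : ℕ → ℝ) : ℝ := 2 * (1 - b) - ∑' n, α (n + 1)

variable {b : ℝ} {α : ℕ → ℝ}

theorem atomEnds_snd (n : ℕ) (a : Fin n → Fin 2) :
    (atomEnds b α n a).2 = (atomEnds b α n a).1 + atomLength b α n := by
  induction n with
  | zero => norm_num [atomEnds, atomLength]
  | succ n ih =>
    simp only [atomEnds, atomLength]
    split_ifs <;> simp only [ih] <;> ring

theorem cantorMass_pos (hα : Admissible b α) : 0 < cantorMass b α := sub_pos.2 hα.tsum_lt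

theorem gapLength_pos (hα : Admissible b α) (n : ℕ) : 0 < gapLength b α n := by
  cases n with
  | zero => exact mul_pos two_pos hα.b_pos
  | succ n => exact div_pos (hα.pos _ n.succ_pos) (by positivity)

/-- Total lengths: the central gap removes 2b, and the 2^i gaps of generation i ≥ 1, each of length
α_i / 2^i, remove α_i. -/
theorem two_pow_mul_atomLength_succ (n : ℕ) :
    2 ^ (n + 1) * atomLength b α (n + 1) = 2 * (1 - b) - ∑ i ∈ Finset.range n, α (i + 1) := by
  induction n with
  | zero => simp [atomLength, gapLength]; ring
  | succ n ih =>
    rw [atomLength, Finset.sum_range_succ, gapLength]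
    have : (2 : ℝ) ^ (n + 1 + 1) * ((atomLength b α (n + 1) - α (n + 1) / 2 ^ (n + 1)) / 2)
        = 2 ^ (n + 1) * atomLength b α (n + 1) - α (n + 1) := by
      field_simp
      ring
    rw [this, ih]
    ring

theorem tendsto_two_pow_mul_atomLength (hα : Admissible b α) :
    Tendsto (fun n => 2 ^ n * atomLength b α n) atTop (𝓝 (cantorMass b α)) := by
  rw [← tendsto_add_atTop_iff_nat 1]
  simp_rw [two_pow_mul_atomLength_succ]
  exact hα.summable.hasSum.tendsto_sum_nat.const_sub _

theorem atomLength_pos (hα : Admissible b α) (n : ℕ) : 0 < atomLength b α n := by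
  cases n with
  | zero => exact two_pos
  | succ n =>
    refine pos_of_mul_pos_right (a := 2 ^ (n + 1)) ?_ (by positivity)
    rw [two_pow_mul_atomLength_succ]
    refine (cantorMass_pos hα).trans_le (sub_le_sub_left ?_ _)
    exact hα.summable.sum_le_tsum _ fun i _ => (hα.pos _ i.succ_pos).le

theorem two_pow_mul_atomLength_le (hα : Admissible b α) (n : ℕ) :
    2 ^ n * atomLength b α n ≤ 2 := by
  cases n with
  | zero => simp [atomLength]
  | succ n =>
    rw [two_pow_mul_atomLength_succ]
    have : 0 ≤ ∑ i ∈ Finset.range n, α (i + 1) :=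
      Finset.sum_nonneg fun i _ => (hα.pos _ i.succ_pos).le
    linarith [hα.b_pos]

theorem tendsto_atomLength (hα : Admissible b α) : Tendsto (atomLength b α) atTop (𝓝 0) := by
  have h := (tendsto_two_pow_mul_atomLength hα).mul
    (tendsto_pow_atTop_nhds_zero_of_lt_one (r := (1 / 2 : ℝ)) (by norm_num) (by norm_num))
  rw [mul_zero] at h
  refine h.congr fun n => ?_
  rw [div_pow, one_pow]
  field_simp

theorem atomEnds_succ_fst (n : ℕ) (a : Fin (n + 1) → Fin 2) :
    (atomEnds b α (n + 1) a).1 = (atomEnds b α n fun i => a i.castSucc).1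
      + if a (Fin.last n) = 0 then 0 else atomLength b α (n + 1) + gapLength b α n := by
  simp only [atomEnds, atomLength]
  split_ifs
  · simp
  · simp only [atomEnds_snd]
    ring

theorem atom_eq_Icc (n : ℕ) (a : Fin n → Fin 2) :
    atom b α n a = Icc (atomEnds b α n a).1 ((atomEnds b α n a).1 + atomLength b α n) := by
  rw [atom, atomEnds_snd]

theorem atom_succ_subset (hα : Admissible b α) (n : ℕ) (a : Fin (n + 1) → Fin 2) :
    atom b α (n + 1) a ⊆ atom b α n fun i => a i.castSucc := by
  rw [atom_eq_Icc, atom_eq_Icc, atomEnds_succ_fst]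
  have h1 : atomLength b α (n + 1) = (atomLength b α n - gapLength b α n) / 2 := rfl
  have h2 := atomLength_pos hα (n + 1)
  have h3 := gapLength_pos hα n
  apply Icc_subset_Icc <;> split_ifs <;> linarith

/-- Two distinct words either have distinct prefixes, where induction applies, or differ only in the
last letter, where a gap of positive length separates the atoms. -/
theorem disjoint_atom (hα : Admissible b α) (n : ℕ) :
    Pairwise (Function.onFun Disjoint (atom b α n)) := by
  induction n with
  | zero => exact fun a a' h => absurd (Subsingleton.elim a a') h
  | succ n ih =>
    intro a a' hne
    by_cases h : (fun i : Fin n => a i.castSucc) = fun i => a' i.castSucc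
    · have hlast : a (Fin.last n) ≠ a' (Fin.last n) := by
        intro hl
        apply hne
        ext i
        induction i using Fin.lastCases with
        | last => rw [hl]
        | cast i => rw [congrFun h i]
      have h2 := atomLength_pos hα (n + 1)
      have h3 := gapLength_pos hα n
      simp only [Function.onFun, atom_eq_Icc, atomEnds_succ_fst, h]
      rw [Set.disjoint_left]
      rintro x ⟨hx1, hx2⟩ ⟨hx3, hx4⟩
      split_ifs at * <;> first | linarith | omega
    · exact (ih h).mono (atom_succ_subset hα n a) (atom_succ_subset hα n a')

theorem atom_subset_Icc (hα : Admissible b α) (n : ℕ) (a : Fin n → Fin 2) :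
    atom b α n a ⊆ Icc (-1) 1 := by
  induction n with
  | zero => exact subset_rfl
  | succ n ih => exact (atom_succ_subset hα n a).trans (ih _)

theorem gap_subset_atom (hα : Admissible b α) (n : ℕ) (a : Fin n → Fin 2) :
    gap b α n a ⊆ atom b α n a := by
  have h1 : atomLength b α (n + 1) = (atomLength b α n - gapLength b α n) / 2 := rfl
  have h2 := atomLength_pos hα (n + 1)
  rw [gap, gapLeft, gapRight, atomCentre, atom_eq_Icc, atomEnds_snd]
  exact Ioo_subset_Icc_self.trans (Icc_subset_Icc (by linarith) (by linarith))

theorem atomCentre_mem_gap (hα : Admissible b α) (n : ℕ) (a : Fin n → Fin 2) :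
    atomCentre b α n a ∈ gap b α n a := by
  have := gapLength_pos hα n
  constructor <;> simp only [gapLeft, gapRight] <;> linarith

theorem atom_one_subset (hα : Admissible b α) (a : Fin 1 → Fin 2) :
    atom b α 1 a ⊆ Icc (-1) (-b) ∪ Icc b 1 := by
  have h := hα.b_pos
  rw [atom_eq_Icc, atomEnds_succ_fst]
  simp only [atomEnds, atomLength, gapLength]
  split_ifs
  · exact (Icc_subset_Icc (by linarith) (by linarith)).trans subset_union_left
  · exact (Icc_subset_Icc (by linarith) (by linarith)).trans subset_union_right

/-- The union of the atoms of generation `n`. -/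
def atomUnion (b : ℝ) (α : ℕ → ℝ) (n : ℕ) : Set ℝ := ⋃ a : Fin n → Fin 2, atom b α n a

theorem isClosed_atomUnion (n : ℕ) : IsClosed (atomUnion b α n) :=
  isClosed_iUnion_of_finite fun _ => isClosed_Icc

theorem antitone_atomUnion (hα : Admissible b α) : Antitone (atomUnion b α) :=
  antitone_nat_of_succ_le fun n => iUnion_subset fun a =>
    (atom_succ_subset hα n a).trans (subset_iUnion (atom b α n) _)

theorem cantorSet_eq : cantorSet b α = ⋂ n, atomUnion b α (n + 1) := rfl

theorem cantorSet_subset_Icc (hα : Admissible b α) : cantorSet b α ⊆ Icc (-1) 1 :=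
  (iInter_subset _ 0).trans (iUnion_subset fun a => atom_subset_Icc hα _ a)

theorem isCompact_cantorSet (hα : Admissible b α) : IsCompact (cantorSet b α) :=
  isCompact_Icc.of_isClosed_subset (isClosed_iInter fun n => isClosed_atomUnion (n + 1))
    (cantorSet_subset_Icc hα)

/-! ### Coding of the Cantor set by sequences of digits -/

/-- The point of the Cantor set with the given itinerary. -/
def coding (b : ℝ) (α : ℕ → ℝ) (ω : ℕ → Fin 2) : ℝ :=
  ⨆ n, (atomEnds b α n fun i => ω i).1

theorem coding_mem_atom (hα : Admissible b α) (ω : ℕ → Fin 2) (n : ℕ) :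
    coding b α ω ∈ atom b α n fun i => ω i := by
  have hanti : Antitone fun n => atom b α n fun i => ω i :=
    antitone_nat_of_succ_le fun n => atom_succ_subset hα n _
  have := ciSup_mem_iInter_Icc_of_antitone_Icc hanti fun n => by
    rw [atomEnds_snd]
    linarith [atomLength_pos hα n]
  exact mem_iInter.1 this n

theorem abs_sub_le_atomLength {n : ℕ} {a : Fin n → Fin 2} {x y : ℝ}
    (hx : x ∈ atom b α n a) (hy : y ∈ atom b α n a) : |x - y| ≤ atomLength b α n := by
  rw [atom_eq_Icc] at hx hy
  rw [abs_le]
  constructor <;> linarith [hx.1, hx.2, hy.1, hy.2]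

theorem atomEnds_fst_mem_atom (hα : Admissible b α) (n : ℕ) (a : Fin n → Fin 2) :
    (atomEnds b α n a).1 ∈ atom b α n a := by
  rw [atom_eq_Icc]
  exact ⟨le_rfl, by linarith [atomLength_pos hα n]⟩

/-- Points of the nested atoms of an itinerary converge to the point with that itinerary. -/
theorem tendsto_coding (hα : Admissible b α) (ω : ℕ → Fin 2) {x : ℕ → ℝ}
    (hx : ∀ n, x n ∈ atom b α n fun i => ω i) : Tendsto x atTop (𝓝 (coding b α ω)) := by
  rw [tendsto_iff_dist_tendsto_zero]
  exact squeeze_zero (fun _ => dist_nonneg)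
    (fun n => abs_sub_le_atomLength (hx n) (coding_mem_atom hα ω n)) (tendsto_atomLength hα)

theorem measurable_atomEnds_fst (n : ℕ) :
    Measurable fun ω : ℕ → Fin 2 => (atomEnds b α n fun i => ω i).1 := by
  have : Measurable fun a : Fin n → Fin 2 => (atomEnds b α n a).1 := .of_discrete
  exact this.comp (by fun_prop)

theorem measurable_coding : Measurable (coding b α) :=
  Measurable.iSup measurable_atomEnds_fst

theorem coding_mem_domain (hα : Admissible b α) (ω : ℕ → Fin 2) :
    coding b α ω ∈ Icc (-1) (-b) ∪ Icc b 1 :=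
  atom_one_subset hα _ (coding_mem_atom hα ω 1)

/-- A Bowen map acts on itineraries as the shift. -/
theorem IsBowenMap.apply_coding (hα : Admissible b α) {G : ℝ → ℝ} (hG : IsBowenMap b α G)
    (ω : ℕ → Fin 2) : G (coding b α ω) = coding b α fun i => ω (i + 1) := by
  -- The hypotheses locate values of G only on gaps, so the coded point is approached by centres of
  -- gaps. Their images lie in the gaps of the shifted word. The limit is taken within the two outer
  -- intervals, where G is continuous.
  have hc : ∀ n, atomCentre b α (n + 1) (fun i => ω i) ∈ atom b α (n + 1) fun i => ω i :=
    fun n => gap_subset_atom hα _ _ (atomCentre_mem_gap hα _ _)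
  have hlim : Tendsto (fun n => atomCentre b α (n + 1) fun i => ω i) atTop
      (𝓝[Icc (-1) (-b) ∪ Icc b 1] coding b α ω) := by
    refine tendsto_nhdsWithin_iff.2 ⟨?_, Eventually.of_forall fun n => ?_⟩
    · rw [tendsto_add_atTop_iff_nat (f := fun n => atomCentre b α n fun i => ω i) 1]
      exact tendsto_coding hα ω fun n => gap_subset_atom hα _ _ (atomCentre_mem_gap hα _ _)
    · have hanti : Antitone fun n => atom b α n fun i => ω i :=
        antitone_nat_of_succ_le fun n => atom_succ_subset hα n _
      exact atom_one_subset hα _ (hanti (Nat.le_add_left 1 n) (hc n))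
  refine tendsto_nhds_unique ((hG.continuousOn _ (coding_mem_domain hα ω)).tendsto.comp hlim)
    (tendsto_coding hα _ fun n => gap_subset_atom hα _ _ ?_)
  exact (hG.image_gap n fun i => ω i).subset (mem_image_of_mem G (atomCentre_mem_gap hα _ _))

/-! ### The normalised Lebesgue measure on the Cantor set is a Bernoulli measure -/

/-- The uniform measure on the two digits. -/
def digitMeasure : Measure (Fin 2) := (PMF.uniformOfFintype (Fin 2)).toMeasure

instance : IsProbabilityMeasure digitMeasure :=
  inferInstanceAs (IsProbabilityMeasure (PMF.uniformOfFintype (Fin 2)).toMeasure)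

/-- The Bernoulli measure with equal weights on sequences of digits. -/
def coinMeasure : Measure (ℕ → Fin 2) := Measure.infinitePi fun _ => digitMeasure

instance : IsProbabilityMeasure coinMeasure :=
  inferInstanceAs (IsProbabilityMeasure (Measure.infinitePi fun _ : ℕ => digitMeasure))

theorem integral_pi_digitMeasure (n : ℕ) (g : (Fin n → Fin 2) → ℝ) :
    ∫ a, g a ∂(Measure.pi fun _ : Fin n => digitMeasure) = (2 ^ n)⁻¹ * ∑ a, g a := by
  rw [integral_fintype .of_finite, Finset.mul_sum]
  refine Finset.sum_congr rfl fun a _ => ?_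
  simp [measureReal_def, Measure.pi_singleton, digitMeasure]

theorem integral_window_coinMeasure (n : ℕ) (g : (Fin n → Fin 2) → ℝ) :
    ∫ ω, g (fun i => ω i) ∂coinMeasure
      = ∫ a, g a ∂(Measure.pi fun _ : Fin n => digitMeasure) := by
  have hg : Measurable g := .of_discrete
  have hw : Measurable fun (ω : ℕ → Fin 2) (i : Fin n) => ω (0 + i) := by fun_prop
  rw [← map_window_infinitePi digitMeasure n 0, integral_map hw.aemeasurable
    hg.aestronglyMeasurable]
  simp [coinMeasure]

theorem map_shift_coinMeasure :
    coinMeasure.map (fun ω i => ω (i + 1)) = coinMeasure :=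
  Measure.map_infinitePi_infinitePi_of_inj (P := fun _ : ℕ => digitMeasure)
    (f := fun i => i + 1) (add_left_injective 1)

/-- Continuous functions oscillate little on atoms of large generation. -/
theorem eventually_forall_atom_abs_sub_le (hα : Admissible b α) {φ : ℝ → ℝ} (hφ : Continuous φ)
    {ε : ℝ} (hε : 0 < ε) :
    ∀ᶠ n in atTop, ∀ (a : Fin n → Fin 2), ∀ x ∈ atom b α n a, ∀ y ∈ atom b α n a,
      |φ x - φ y| ≤ ε := by
  obtain ⟨δ, hδ, h⟩ := Metric.uniformContinuousOn_iff.1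
    (isCompact_Icc.uniformContinuousOn_of_continuous (hφ.continuousOn (s := Icc (-1) 1))) ε hε
  filter_upwards [(tendsto_atomLength hα).eventually_lt_const hδ] with n hn a x hx y hy
  exact (h x (atom_subset_Icc hα n a hx) y (atom_subset_Icc hα n a hy)
    ((abs_sub_le_atomLength hx hy).trans_lt hn)).le

theorem volume_real_atom (hα : Admissible b α) (n : ℕ) (a : Fin n → Fin 2) :
    volume.real (atom b α n a) = atomLength b α n := by
  rw [atom_eq_Icc, Real.volume_real_Icc_of_le (by linarith [atomLength_pos hα n])]
  ring

theorem abs_integral_atom_sub_le (hα : Admissible b α) {φ : ℝ → ℝ} (hφ : Continuous φ)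
    {ε : ℝ} (n : ℕ) (a : Fin n → Fin 2)
    (h : ∀ x ∈ atom b α n a, |φ x - φ (atomEnds b α n a).1| ≤ ε) :
    |(∫ x in atom b α n a, φ x) - atomLength b α n * φ (atomEnds b α n a).1|
      ≤ ε * atomLength b α n := by
  have hfin : volume (atom b α n a) < ⊤ := isCompact_Icc.measure_lt_top
  have h1 := norm_setIntegral_le_of_norm_le_const (μ := volume)
    (f := fun x => φ x - φ (atomEnds b α n a).1) hfin h
  have hint : IntegrableOn φ (atom b α n a) := hφ.continuousOn.integrableOn_compact isCompact_Icc
  rw [integral_sub hint (integrableOn_const hfin.ne), setIntegral_const, volume_real_atom hα,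
    smul_eq_mul] at h1
  exact h1

/-- A Riemann sum estimate: atoms of one generation have equal length, so the sum over left
endpoints is a multiple of the uniform average over words, that is, of a coin integral. The 2 in the
error bounds the total length of the atoms. -/
theorem abs_integral_atomUnion_sub_le (hα : Admissible b α) {φ : ℝ → ℝ} (hφ : Continuous φ)
    {ε : ℝ} (hε : 0 ≤ ε) (n : ℕ)
    (h : ∀ (a : Fin n → Fin 2), ∀ x ∈ atom b α n a, ∀ y ∈ atom b α n a, |φ x - φ y| ≤ ε) :
    |(∫ x in atomUnion b α n, φ x) - 2 ^ n * atomLength b α n *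
      ∫ ω, φ (atomEnds b α n fun i => ω i).1 ∂coinMeasure| ≤ 2 * ε := by
  rw [integral_window_coinMeasure n fun a => φ (atomEnds b α n a).1, integral_pi_digitMeasure,
    atomUnion, integral_iUnion_fintype (s := atom b α n) (fun _ => measurableSet_Icc)
      (disjoint_atom hα n) fun _ => hφ.continuousOn.integrableOn_compact isCompact_Icc]
  have h2 : (2 : ℝ) ^ n * atomLength b α n *
      ((2 ^ n)⁻¹ * ∑ a : Fin n → Fin 2, φ (atomEnds b α n a).1)
      = ∑ a : Fin n → Fin 2, atomLength b α n * φ (atomEnds b α n a).1 := by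
    rw [← Finset.mul_sum]
    field_simp
  rw [h2, ← Finset.sum_sub_distrib]
  calc _ ≤ ∑ a : Fin n → Fin 2, |(∫ x in atom b α n a, φ x)
          - atomLength b α n * φ (atomEnds b α n a).1| := Finset.abs_sum_le_sum_abs _ _
    _ ≤ ∑ _a : Fin n → Fin 2, ε * atomLength b α n := Finset.sum_le_sum fun a _ =>
        abs_integral_atom_sub_le hα hφ n a fun x hx => h a x hx _ (atomEnds_fst_mem_atom hα n a)
    _ = ε * (2 ^ n * atomLength b α n) := by
        simp
        ring
    _ ≤ ε * 2 := by
        gcongr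
        exact two_pow_mul_atomLength_le hα n
    _ = 2 * ε := mul_comm _ _

theorem tendsto_integral_atomEnds (hα : Admissible b α) {φ : ℝ → ℝ} (hφ : Continuous φ)
    {C : ℝ} (hC : ∀ x, |φ x| ≤ C) :
    Tendsto (fun n => ∫ ω, φ (atomEnds b α n fun i => ω i).1 ∂coinMeasure) atTop
      (𝓝 (∫ ω, φ (coding b α ω) ∂coinMeasure)) := by
  refine tendsto_integral_of_dominated_convergence (fun _ => C)
    (fun n => (hφ.measurable.comp (measurable_atomEnds_fst n)).aestronglyMeasurable)
    (integrable_const C) (fun n => ae_of_all _ fun ω => hC _) (ae_of_all _ fun ω => ?_)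
  exact (hφ.tendsto _).comp (tendsto_coding hα ω fun n => atomEnds_fst_mem_atom hα n _)

/-- Both sides are limits over generations: the left one because the unions of atoms decrease to K,
the right one by dominated convergence of left endpoints to codings. The Riemann sum error between
them tends to 0. -/
theorem integral_cantorSet (hα : Admissible b α) {φ : ℝ → ℝ} (hφ : Continuous φ)
    {C : ℝ} (hC : ∀ x, |φ x| ≤ C) :
    ∫ x in cantorSet b α, φ x = cantorMass b α * ∫ ω, φ (coding b α ω) ∂coinMeasure := by
  have h1 : Tendsto (fun n => ∫ x in atomUnion b α n, φ x) atTop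
      (𝓝 (∫ x in cantorSet b α, φ x)) := by
    rw [← tendsto_add_atTop_iff_nat 1, cantorSet_eq]
    refine tendsto_setIntegral_of_antitone (fun n => (isClosed_atomUnion (n + 1)).measurableSet)
      ((antitone_atomUnion hα).comp_monotone fun _ _ h => Nat.add_le_add_right h 1) ⟨0, ?_⟩
    exact hφ.continuousOn.integrableOn_compact (isCompact_Icc.of_isClosed_subset
      (isClosed_atomUnion _) (iUnion_subset fun a => atom_subset_Icc hα _ a))
  have h2 := (tendsto_two_pow_mul_atomLength hα).mul (tendsto_integral_atomEnds hα hφ hC)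
  refine tendsto_nhds_unique h1 (h2.congr_dist ?_)
  rw [Metric.tendsto_atTop']
  intro ε hε
  obtain ⟨N, hN⟩ := eventually_atTop.1
    -- Oscillation ε/4 gives a Riemann sum error of at most ε/2 < ε.
    (eventually_forall_atom_abs_sub_le hα hφ (ε := ε / 4) (by positivity))
  refine ⟨N, fun n hn => ?_⟩
  have := abs_integral_atomUnion_sub_le hα hφ (by positivity) n (hN n hn.le)
  rw [Real.dist_eq, Real.dist_eq, sub_zero, abs_abs, abs_sub_comm]
  linarith

/-- Finite Borel measures on the line are determined by their integrals of bounded continuous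
functions. -/
theorem volume_restrict_cantorSet (hα : Admissible b α) :
    volume.restrict (cantorSet b α)
      = ENNReal.ofReal (cantorMass b α) • coinMeasure.map (coding b α) := by
  have : IsFiniteMeasure (volume.restrict (cantorSet b α)) :=
    ⟨by simpa using (isCompact_cantorSet hα).measure_lt_top⟩
  have : IsProbabilityMeasure (coinMeasure.map (coding b α)) :=
    Measure.isProbabilityMeasure_map measurable_coding.aemeasurable
  have : IsFiniteMeasure (ENNReal.ofReal (cantorMass b α) • coinMeasure.map (coding b α)) :=
    Measure.smul_finite _ ENNReal.ofReal_ne_top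
  refine ext_of_forall_integral_eq_of_IsFiniteMeasure fun φ => ?_
  rw [integral_smul_measure, ENNReal.toReal_ofReal (cantorMass_pos hα).le,
    integral_map measurable_coding.aemeasurable φ.continuous.aestronglyMeasurable,
    integral_cantorSet hα φ.continuous fun x => φ.norm_coe_le_norm x, smul_eq_mul]

/-! ### Passage to the circle -/

/-- The point of the circle with the given itinerary. -/
def circleCoding (b : ℝ) (α : ℕ → ℝ) (ω : ℕ → Fin 2) : Circle2 := (coding b α ω : Circle2)

theorem measurable_coe_circle : Measurable fun x : ℝ => (x : Circle2) :=
  (AddCircle.continuous_mk' 2).measurable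

theorem measurable_circleCoding : Measurable (circleCoding b α) :=
  measurable_coe_circle.comp measurable_coding

theorem coe_one_eq_coe_neg_one : ((1 : ℝ) : Circle2) = ((-1 : ℝ) : Circle2) := by
  have := AddCircle.coe_add_period (2 : ℝ) (-1)
  norm_num at this
  simpa using this

/-- Only ±1 are identified on the circle, and they form a null set; elsewhere on (-1, 1] the
projection is injective. -/
theorem coe_preimage_circleCantorSet_ae_eq (hα : Admissible b α) :
    ((fun x : ℝ => (x : Circle2)) ⁻¹' circleCantorSet b α ∩ Ioc (-1) (-1 + 2) : Set ℝ)
      =ᵐ[volume] cantorSet b α := by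
  have h1 : ∀ᵐ x : ℝ, x ≠ 1 := by simp [ae_iff]
  have h2 : ∀ᵐ x : ℝ, x ≠ -1 := by simp [ae_iff]
  filter_upwards [h1, h2] with x hx1 hx2
  refine propext ⟨?_, fun hx => ⟨⟨x, hx, rfl⟩, ?_⟩⟩
  · rintro ⟨⟨y, hy, hyx⟩, hx⟩
    have hyI := cantorSet_subset_Icc hα hy
    replace hyx : (y : Circle2) = x := hyx
    rcases eq_or_lt_of_le hyI.1 with h | h
    · rw [← h, ← coe_one_eq_coe_neg_one,
        AddCircle.coe_eq_coe_iff_of_mem_Ioc (a := -1) ⟨by norm_num, by norm_num⟩ hx] at hyx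
      exact absurd hyx.symm hx1
    · rw [AddCircle.coe_eq_coe_iff_of_mem_Ioc (a := -1) ⟨h, by linarith [hyI.2]⟩ hx] at hyx
      exact hyx ▸ hy
  · have := cantorSet_subset_Icc hα hx
    exact ⟨lt_of_le_of_ne this.1 hx2.symm, by linarith [this.2]⟩

theorem volume_restrict_circleCantorSet (hα : Admissible b α) :
    (volume : Measure Circle2).restrict (circleCantorSet b α)
      = (volume.restrict (cantorSet b α)).map fun x : ℝ => (x : Circle2) := by
  have hK : MeasurableSet (circleCantorSet b α) :=
    ((isCompact_cantorSet hα).image (AddCircle.continuous_mk' 2)).isClosed.measurableSet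
  have h := (AddCircle.measurePreserving_mk 2 (-1)).restrict_preimage hK
  rw [← h.map_eq, Measure.restrict_restrict (measurable_coe_circle hK),
    Measure.restrict_congr_set (coe_preimage_circleCantorSet_ae_eq hα)]

theorem muK_eq_map_circleCoding (hα : Admissible b α) :
    muK b α = coinMeasure.map (circleCoding b α) := by
  have hc : ENNReal.ofReal (cantorMass b α) ≠ 0 := by
    simpa using cantorMass_pos hα
  have : IsProbabilityMeasure (coinMeasure.map (circleCoding b α)) :=
    Measure.isProbabilityMeasure_map measurable_circleCoding.aemeasurable
  have h : (volume : Measure Circle2).restrict (circleCantorSet b α)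
      = ENNReal.ofReal (cantorMass b α) • coinMeasure.map (circleCoding b α) := by
    rw [volume_restrict_circleCantorSet hα, volume_restrict_cantorSet hα, Measure.map_smul,
      Measure.map_map measurable_coe_circle measurable_coding]
    rfl
  have hvol : (volume : Measure Circle2) (circleCantorSet b α)
      = ENNReal.ofReal (cantorMass b α) := by
    rw [← Measure.restrict_apply_univ, h]
    simp
  rw [muK, h, hvol, smul_smul, ENNReal.inv_mul_cancel hc ENNReal.ofReal_ne_top, one_smul]

theorem muK_absolutelyContinuous : muK b α ≪ volume :=
  (Measure.restrict_le_self.absolutelyContinuous).smul_left _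

/-! ### The dynamics on the circle -/

theorem coding_zero (hα : Admissible b α) : coding b α (fun _ => 0) = -1 := by
  have h : ∀ n, (atomEnds b α n fun _ => 0).1 = -1 := by
    intro n
    induction n with
    | zero => rfl
    | succ n ih => simp [atomEnds_succ_fst, ih]
  refine tendsto_nhds_unique (tendsto_coding hα (fun _ => 0)
    fun n => atomEnds_fst_mem_atom hα n _) ?_
  simp_rw [h]
  exact tendsto_const_nhds

theorem coding_one (hα : Admissible b α) : coding b α (fun _ => 1) = 1 := by
  have h : ∀ n, (atomEnds b α n fun _ => 1).2 = 1 := by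
    intro n
    induction n with
    | zero => rfl
    | succ n ih => simp [atomEnds, ih]
  refine tendsto_nhds_unique (tendsto_coding hα (fun _ => 1) (x := fun _ => 1) fun n => ?_)
    tendsto_const_nhds
  have h1 := atomEnds_snd (b := b) (α := α) n fun _ => 1
  rw [h] at h1
  rw [atom_eq_Icc, ← h1]
  exact ⟨by linarith [atomLength_pos hα n], le_rfl⟩

/-- The circle map acts on itineraries as the shift. -/
theorem circleMap_circleCoding (hα : Admissible b α) {G : ℝ → ℝ} (hG : IsBowenMap b α G)
    (Gc : ℝ → ℝ) (ω : ℕ → Fin 2) :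
    circleMap b G Gc (circleCoding b α ω) = circleCoding b α fun i => ω (i + 1) := by
  have key : ∀ ω, coding b α ω < 1 →
      circleMap b G Gc (circleCoding b α ω) = circleCoding b α fun i => ω (i + 1) := by
    intro ω hlt
    have hmem := atom_subset_Icc hα _ _ (coding_mem_atom hα ω 0)
    have hnot : coding b α ω ∉ Ioo (-b) b := by
      rintro ⟨h1, h2⟩
      rcases coding_mem_domain hα ω with h | h
      · exact h1.not_ge h.2
      · exact h2.not_ge h.1
    rw [circleMap, circleCoding, AddCircle.liftIco_coe_apply ⟨hmem.1, by linarith⟩, intervalMap,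
      if_neg hnot, hG.apply_coding hα]
    rfl
  have hmem := atom_subset_Icc hα _ _ (coding_mem_atom hα ω 0)
  rcases hmem.2.lt_or_eq with h | h
  · exact key ω h
  -- The point 1 is the class of -1 on the circle, where the map is computed from G(-1). The
  -- constant words 0 and 1 are fixed by the shift, so G fixes -1 and 1, and the two computations
  -- agree.
  · have h0 := key (fun _ => 0) (by rw [coding_zero hα]; norm_num)
    have h1 : coding b α (fun i => ω (i + 1)) = 1 := by
      rw [← hG.apply_coding hα, h, ← coding_one hα, hG.apply_coding hα]
    simp only [circleCoding, coding_zero hα, h, h1] at h0 ⊢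
    rwa [coe_one_eq_coe_neg_one]

theorem circleMap_iterate_circleCoding (hα : Admissible b α) {G : ℝ → ℝ}
    (hG : IsBowenMap b α G) (Gc : ℝ → ℝ) (j : ℕ) (ω : ℕ → Fin 2) :
    (circleMap b G Gc)^[j] (circleCoding b α ω) = circleCoding b α fun i => ω (j + i) := by
  induction j with
  | zero => simp
  | succ j ih =>
    rw [Function.iterate_succ_apply', ih, circleMap_circleCoding hα hG]
    congr 1
    ext i
    congr 2
    omega

/-- The fundamental domain [-1, 1) is covered by two measurable pieces, the central interval and the
outer intervals, and the interval map is continuous on each. -/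
theorem measurable_circleMap (hα : Admissible b α) {G Gc : ℝ → ℝ} (hG : IsBowenMap b α G)
    (hGc : IsCentralBranch b Gc) : Measurable (circleMap b G Gc) := by
  have hb := hα.b_pos
  have h1 : Measurable (fun x : Ico (-1 : ℝ) (-1 + 2) => intervalMap b G Gc x) := by
    have hcov : Ico (-1 : ℝ) (-1 + 2) ⊆ Ioo (-b) b ∪ (Icc (-1) (-b) ∪ Icc b 1) := by
      rintro x ⟨hx1, hx2⟩
      by_cases h : x ∈ Ioo (-b) b
      · exact Or.inl h
      · rw [mem_Ioo, not_and_or, not_lt, not_lt] at h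
        exact Or.inr (h.imp (fun h => ⟨hx1, h⟩) fun h => ⟨h, by linarith⟩)
    refine measurable_of_measurable_union_cover (Subtype.val ⁻¹' Ioo (-b) b)
      (Subtype.val ⁻¹' (Icc (-1) (-b) ∪ Icc b 1)) (measurable_subtype_coe measurableSet_Ioo)
      (measurable_subtype_coe (measurableSet_Icc.union measurableSet_Icc))
      (fun x _ => hcov x.2) ?_ ?_
    · refine Continuous.measurable ?_
      refine (hGc.contDiffOn.continuousOn.comp_continuous
        (continuous_subtype_val.comp continuous_subtype_val)
        fun a => Ioo_subset_Icc_self a.2).congr fun a => ?_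
      exact (if_pos a.2).symm
    · refine Continuous.measurable ?_
      refine (hG.continuousOn.comp_continuous
        (continuous_subtype_val.comp continuous_subtype_val) fun a => a.2).congr fun a => ?_
      refine (if_neg ?_).symm
      rintro ⟨h1, h2⟩
      rcases a.2 with h | h
      · exact h1.not_ge h.2
      · exact h2.not_ge h.1
  exact (measurable_coe_circle.comp h1).comp (AddCircle.measurableEquivIco 2 (-1)).measurable

theorem measurePreserving_circleMap (hα : Admissible b α) {G Gc : ℝ → ℝ}
    (hG : IsBowenMap b α G) (hGc : IsCentralBranch b Gc) :
    MeasurePreserving (circleMap b G Gc) (muK b α) (muK b α) := by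
  have hm := measurable_circleMap hα hG hGc
  have hs : Measurable fun (ω : ℕ → Fin 2) i => ω (i + 1) := by fun_prop
  refine ⟨hm, ?_⟩
  rw [muK_eq_map_circleCoding hα, Measure.map_map hm measurable_circleCoding]
  have : circleMap b G Gc ∘ circleCoding b α
      = circleCoding b α ∘ fun (ω : ℕ → Fin 2) i => ω (i + 1) :=
    funext fun ω => circleMap_circleCoding hα hG Gc ω
  rw [this, ← Measure.map_map measurable_circleCoding hs, map_shift_coinMeasure]

/-- For n = 0 both sides are 0: the sums are empty. -/
theorem integral_empiricMeasure {X : Type*} [TopologicalSpace X] [MeasurableSpace X]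
    [MeasurableSingletonClass X] (f : X → X) (n : ℕ) (x : X) (φ : X → ℝ) :
    ∫ y, φ y ∂(empiricMeasure f n x) = (∑ j ∈ Finset.range n, φ (f^[j] x)) / n := by
  rw [empiricMeasure, integral_smul_measure, integral_finsetSum_measure fun j _ =>
    integrable_dirac (by simp)]
  simp [div_eq_inv_mul]

/-- Cesàro averages of uniformly approximable sequences converge. -/
theorem tendsto_average_of_forall_approx {y : ℕ → ℝ} {p : ℝ}
    (h : ∀ ε > 0, ∃ (z : ℕ → ℝ) (q : ℝ), (∀ j, |y j - z j| ≤ ε) ∧ |p - q| ≤ ε ∧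
      Tendsto (fun n : ℕ => (∑ j ∈ Finset.range n, z j) / n) atTop (𝓝 q)) :
    Tendsto (fun n : ℕ => (∑ j ∈ Finset.range n, y j) / n) atTop (𝓝 p) := by
  rw [Metric.tendsto_atTop]
  intro ε hε
  obtain ⟨z, q, hyz, hpq, hz⟩ := h (ε / 4) (by positivity)
  obtain ⟨N, hN⟩ := Metric.tendsto_atTop.1 hz (ε / 4) (by positivity)
  refine ⟨N, fun n hn => ?_⟩
  have h1 := hN n hn
  have h2 : |(∑ j ∈ Finset.range n, y j) / n - (∑ j ∈ Finset.range n, z j) / n| ≤ ε / 4 := by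
    rw [← sub_div, ← Finset.sum_sub_distrib, abs_div, Nat.abs_cast]
    refine div_le_of_le_mul₀ (by positivity) (by positivity) ?_
    refine (Finset.abs_sum_le_sum_abs _ _).trans ?_
    refine (Finset.sum_le_sum fun j _ => hyz j).trans ?_
    simp [mul_comm]
  rw [Real.dist_eq] at h1 ⊢
  rw [abs_lt] at h1 ⊢
  rw [abs_le] at h2 hpq
  constructor <;> linarith [h1.1, h1.2, h2.1, h2.2, hpq.1, hpq.2]

theorem ae_circleCoding_mem_basin (hα : Admissible b α) {G : ℝ → ℝ} (hG : IsBowenMap b α G)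
    (Gc : ℝ → ℝ) :
    ∀ᵐ ω ∂coinMeasure, circleCoding b α ω ∈ basin (circleMap b G Gc) (muK b α) := by
  filter_upwards [ae_forall_tendsto_window_average digitMeasure] with ω hω φ hφ
  have hψ : Continuous fun x : ℝ => φ x := hφ.comp (AddCircle.continuous_mk' 2)
  obtain ⟨C, hC⟩ : ∃ C, ∀ x, |φ x| ≤ C := by
    obtain ⟨C, hC⟩ := isCompact_univ.exists_bound_of_continuousOn hφ.continuousOn
    exact ⟨C, fun x => hC x (mem_univ x)⟩
  simp_rw [integral_empiricMeasure, circleMap_iterate_circleCoding hα hG]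
  rw [muK_eq_map_circleCoding hα,
    integral_map measurable_circleCoding.aemeasurable hφ.measurable.aestronglyMeasurable]
  refine tendsto_average_of_forall_approx fun ε hε => ?_
  -- Replacing a coded point by the left endpoint of its atom of generation k changes φ by at most ε
  -- and leaves a function of the first k digits, to which genericity of `ω` applies.
  obtain ⟨k, hk⟩ := (eventually_forall_atom_abs_sub_le hα hψ hε).exists
  have hclose : ∀ ω' : ℕ → Fin 2,
      |φ (circleCoding b α ω') - φ ((atomEnds b α k fun i => ω' i).1 : ℝ)| ≤ ε := fun ω' =>
    hk _ _ (coding_mem_atom hα ω' k) _ (atomEnds_fst_mem_atom hα k _)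
  refine ⟨_, _, fun j => hclose fun i => ω (j + i), ?_,
    hω k fun a => φ ((atomEnds b α k a).1 : ℝ)⟩
  have hint1 : Integrable (fun ω' => φ (circleCoding b α ω')) coinMeasure :=
    .of_bound (hφ.measurable.comp measurable_circleCoding).aestronglyMeasurable C
      (ae_of_all _ fun _ => hC _)
  have hint2 : Integrable (fun ω' : ℕ → Fin 2 => φ ((atomEnds b α k fun i => ω' i).1 : ℝ))
      coinMeasure :=
    .of_bound (hψ.measurable.comp (measurable_atomEnds_fst k)).aestronglyMeasurable C
      (ae_of_all _ fun _ => hC _)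
  rw [← integral_window_coinMeasure k fun a => φ ((atomEnds b α k a).1 : ℝ),
    ← integral_sub hint1 hint2]
  have hnorm : ∀ᵐ ω' ∂coinMeasure,
      ‖φ (circleCoding b α ω') - φ ((atomEnds b α k fun i => ω' i).1 : ℝ)‖ ≤ ε :=
    ae_of_all _ hclose
  refine (norm_integral_le_of_norm_le_const hnorm).trans ?_
  simp

/-- Measurability of the basin is not needed: if the basin is null, it lies in a measurable null
set, which is also μ_K-null by absolute continuity. Almost every coding would then avoid this set
and yet lie in the basin. -/
theorem volume_basin_pos (hα : Admissible b α) {G : ℝ → ℝ} (hG : IsBowenMap b α G)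
    (Gc : ℝ → ℝ) : 0 < (volume : Measure Circle2) (basin (circleMap b G Gc) (muK b α)) := by
  rw [pos_iff_ne_zero]
  intro h0
  have h1 : muK b α (toMeasurable volume (basin (circleMap b G Gc) (muK b α))) = 0 :=
    muK_absolutelyContinuous (by rw [measure_toMeasurable, h0])
  -- The measure also occurs inside the basin; only the outer occurrence is rewritten.
  nth_rw 1 [muK_eq_map_circleCoding hα] at h1
  rw [Measure.map_apply measurable_circleCoding (measurableSet_toMeasurable _ _)] at h1
  have h2 : ∀ᵐ _ω ∂coinMeasure, False := by
    filter_upwards [ae_circleCoding_mem_basin hα hG Gc, measure_eq_zero_iff_ae_notMem.1 h1]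
      with ω hω hω'
    exact hω' (subset_toMeasurable _ _ hω)
  exact h2.exists.elim fun _ h => h

end BowenCircle

end

theorem mainTheorem5 (b : ℝ) (α : ℕ → ℝ) (hα : BowenCircle.Admissible b α)
    (G : ℝ → ℝ) (hG : BowenCircle.IsBowenMap b α G)
    (Gc : ℝ → ℝ) (hGc : BowenCircle.IsCentralBranch b Gc) :
    BowenCircle.IsPhysical (BowenCircle.circleMap b G Gc)
      (volume : Measure BowenCircle.Circle2) (BowenCircle.muK b α) where
  isProbabilityMeasure := by
    rw [BowenCircle.muK_eq_map_circleCoding hα]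
    exact Measure.isProbabilityMeasure_map BowenCircle.measurable_circleCoding.aemeasurable
  invariant := BowenCircle.measurePreserving_circleMap hα hG hGc
  basin_pos := BowenCircle.volume_basin_pos hα hG Gc
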